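/- Let $d\ge 1$ be an integer, let $\mathbf c=(c_0,c_1,\dots,c_d)\in(0,\infty)^{d+1}$ satisfy $\sum_{i=1}^d c_i<1$, and let $\nu$ be a probability measure on $\mathbb R^d$ with $\int_{\mathbb R^d}|x|\,\nu(dx)<\infty$. Let $\mathcal M_0(\mathbf c)$ be the set of measurable functions $m:\mathbb R^d\to\mathbb R$ with $|m(x)|\le c_0+\sum_{i=1}^d c_i|x_i|$ for all $x\in\mathbb R^d$. For $m\in\mathcal M_0(\mathbf c)$ and an integer $T\geq 0$, consider the nonlinear AR($d$) model \[ Y_t=m(Y_{t-1},\dots,Y_{t-d})+v_t\quad(t=1,\dots,T),\qquad (Y_0,Y_{-1},\dots,Y_{-d+1})\sim\nu, \] where $v_1,\dots,v_T$ are i.i.d. $N(0,1)$ and independent of $(Y_0,\dots,Y_{-d+1})$. For sub-$\sigma$-fields $\mathcal A,\mathcal B$ of a probability space put \[ \beta(\mathcal A,\mathcal B)=\frac12\sup\sum_{i\in I}\sum_{j\in J}\left|P(A_i\cap B_j)-P(A_i)P(B_j)\right|, \] the supremum being over all finite partitions $\{A_i\}_{i\in I}\subset\mathcal A$ and $\{B_j\}_{j\in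 J}\subset\mathcal B$ of the space, and let \[ \beta_Y(t)=\sup_{1\le k\le T-t}\beta\bigl(\sigma(Y_1,\dots,Y_k),\,\sigma(Y_{k+t},\dots,Y_T)\bigr), \] with $\beta_Y(t)=0$ if $t\ge T$. Then there are constants $C_\beta>0$ and $C'_\beta>0$, depending only on $\mathbf c$, $d$ and $\nu$ (in particular, neither on $m$ nor on $T$), such that for every $m\in\mathcal M_0(\mathbf c)$, every $T$, and every such process $Y=\{Y_t\}_{t=1}^T$, \[ \beta_Y(t)\le C'_\beta e^{-C_\beta t}\qquad\text{for all integers }t\ge1 . \] -/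

import Mathlib

open MeasureTheory ProbabilityTheory
open scoped ENNReal

noncomputable section

/-- A finite family of sets that belong to the σ-field `𝒜` and partition the whole space. -/
structure IsFinitePartition {Ω : Type*} (𝒜 : MeasurableSpace Ω) {n : ℕ}
    (A : Fin n → Set Ω) : Prop where
  measurableSet : ∀ i, MeasurableSet[𝒜] (A i)
  disjoint : ∀ i j, i ≠ j → Disjoint (A i) (A j)
  iUnion_eq : ⋃ i, A i = Set.univ

/-- The β-mixing coefficient of two sub-σ-fields `𝒜`, `ℬ` of a probability space:
half of the supremum of `∑ i, ∑ j, |P(A i ∩ B j) - P(A i) P(B j)|` over all finite partitions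
`A` of the space into sets of `𝒜` and `B` into sets of `ℬ`.
It takes values in `[0, ∞]`, so that the supremum always exists. -/
def betaCoeff {Ω : Type*} {_ : MeasurableSpace Ω} (P : Measure Ω) (𝒜 ℬ : MeasurableSpace Ω) : ℝ≥0∞ :=
  2⁻¹ * ⨆ (n : ℕ) (k : ℕ) (A : Fin n → Set Ω) (B : Fin k → Set Ω)
    (_ : IsFinitePartition 𝒜 A) (_ : IsFinitePartition ℬ B),
    ENNReal.ofReal (∑ i, ∑ j, |P.real (A i ∩ B j) - P.real (A i) * P.real (B j)|)

/-- The σ-field generated by the variables `Y s` with `a ≤ s ≤ b`. -/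
abbrev sigmaField {Ω : Type*} (Y : ℤ → Ω → ℝ) (a b : ℤ) : MeasurableSpace Ω :=
  ⨆ s ∈ Set.Icc a b, MeasurableSpace.comap (Y s) (borel ℝ)

/-- The β-mixing coefficient at lag `t` of the process `Y 1, …, Y T`: the supremum over `k`
of the coefficient between `σ(Y 1, …, Y k)` and `σ(Y (k + t), …, Y T)`.
(For `k + t > T` the second σ-field would be trivial and the coefficient zero.) -/
def betaMixing {Ω : Type*} [MeasurableSpace Ω] (P : Measure Ω) (Y : ℤ → Ω → ℝ) (T t : ℕ) : ℝ≥0∞ :=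
  ⨆ (k : ℤ) (_ : 1 ≤ k ∧ k + t ≤ T), betaCoeff P (sigmaField Y 1 k) (sigmaField Y (k + t) T)

/-- The vector `(Y (t - 1), Y (t - 2), …, Y (t - d))`. -/
def lagVector {Ω : Type*} (d : ℕ) (Y : ℤ → Ω → ℝ) (t : ℤ) (ω : Ω) : Fin d → ℝ :=
  fun i => Y (t - 1 - (i : ℕ)) ω

/-- `Y` (at the times `1 - d, …, T`) follows the nonlinear AR(`d`) model with regression function
`m`, initial law `ν` and innovations `v 1, …, v T`, on the probability space `(Ω, P)`. -/
structure IsNonlinearAR {Ω : Type*} [MeasurableSpace Ω] (P : Measure Ω) (d T : ℕ)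
    (ν : Measure (Fin d → ℝ)) (m : (Fin d → ℝ) → ℝ) (Y v : ℤ → Ω → ℝ) : Prop where
  measurable_Y : ∀ t ∈ Set.Icc (1 - (d : ℤ)) T, Measurable (Y t)
  measurable_v : ∀ t ∈ Set.Icc (1 : ℤ) T, Measurable (v t)
  recursion : ∀ t ∈ Set.Icc (1 : ℤ) T, ∀ᵐ ω ∂P, Y t ω = m (lagVector d Y t ω) + v t ω
  /-- the law of `(Y 0, Y (-1), …, Y (1 - d))` is `ν` -/
  law_init : P.map (lagVector d Y 1) = ν
  law_v : ∀ t ∈ Set.Icc (1 : ℤ) T, P.map (v t) = gaussianReal 0 1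
  iIndepFun_v : iIndepFun (fun t : Set.Icc (1 : ℤ) T => v t) P
  indepFun_init : IndepFun (lagVector d Y 1) (fun ω (t : Set.Icc (1 : ℤ) T) => v t ω) P

/-- The class of measurable `m : ℝᵈ → ℝ` with `|m x| ≤ c₀ + ∑ᵢ cᵢ |xᵢ|` for all `x`, where
`c = (c₀, c₁, …, c_d)`. -/
def regressionClass {d : ℕ} (c : Fin (d + 1) → ℝ) : Set ((Fin d → ℝ) → ℝ) :=
  {m | Measurable m ∧ ∀ x, |m x| ≤ c 0 + ∑ i : Fin d, c i.succ * |x i|}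

end

open scoped NNReal

/-! The lag vectors form a Markov chain with kernel `pushKernel m (gaussianReal 0 1)`, and Harris'
theorem applies to its `d`-step kernel with constants that do not see `m` or `T`. Since the slopes
sum to less than one, a weighted ℓ¹ norm `V` satisfies a drift inequality (`exists_weights`,
`lintegral_weightedNorm_push_le`). After `d` steps every coordinate is fresh; on a box all
admissible `m` share a bound, so the Gaussian noise gives one minorizing measure for all of them
(`exists_minorization`). Drift and minorization together contract the oscillation weighted by `V`
(`exists_oscLE_contraction`).

Mixing follows by duality. The conditional mean of a bounded function of the future from time `k +
t` on, given the past up to `k`, is the `(t - 1)`-fold image under the kernel of some bounded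
function, evaluated at the state at time `k` (`exists_setIntegral_eq`, `setIntegral_iterate`; both
rest on `indep_past`). Its weighted oscillation is at most `ρ ^ ((t - 1) / d)`. By
`betaCoeff_le_of_oscLE` this bounds the β-coefficient up to the moment of `V`, which
`lintegral_lagVector_le` controls uniformly in time. -/

noncomputable section

/-! ### Harris' theorem for a weighted oscillation seminorm. -/

section Harris

variable {E : Type*} [MeasurableSpace E]

/-- The action of a kernel on real functions. -/
def kernelOp (κ : Kernel E E) (φ : E → ℝ) (x : E) : ℝ := ∫ y, φ y ∂κ x

/-- Measurable functions bounded by one. -/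
def UnitMeasurable (φ : E → ℝ) : Prop := Measurable φ ∧ ∀ x, |φ x| ≤ 1

lemma integrable_of_bounded {α : Type*} [MeasurableSpace α] {μ : Measure α} [IsFiniteMeasure μ]
    {φ : α → ℝ} (hm : Measurable φ) {b : ℝ} (hb : ∀ x, |φ x| ≤ b) : Integrable φ μ :=
  Integrable.of_bound hm.aestronglyMeasurable b (ae_of_all _ hb)

lemma abs_integral_le_one {α : Type*} [MeasurableSpace α] {μ : Measure α} [IsProbabilityMeasure μ]
    {φ : α → ℝ} (hb : ∀ x, |φ x| ≤ 1) : |∫ x, φ x ∂μ| ≤ 1 := by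
  simpa using norm_integral_le_of_norm_le_const (f := φ) (C := 1) (μ := μ) (ae_of_all _ hb)

lemma UnitMeasurable.kernelOp {κ : Kernel E E} [IsMarkovKernel κ] {φ : E → ℝ}
    (h : UnitMeasurable φ) : UnitMeasurable (kernelOp κ φ) :=
  ⟨(h.1.stronglyMeasurable.integral_kernel (κ := κ)).measurable, fun _ => abs_integral_le_one h.2⟩

lemma UnitMeasurable.iterate_kernelOp {κ : Kernel E E} [IsMarkovKernel κ] {φ : E → ℝ}
    (h : UnitMeasurable φ) (n : ℕ) : UnitMeasurable ((_root_.kernelOp κ)^[n] φ) := by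
  induction n with
  | zero => exact h
  | succ n ih => rw [Function.iterate_succ_apply']; exact ih.kernelOp

instance isMarkovKernel_pow (κ : Kernel E E) [IsMarkovKernel κ] (n : ℕ) :
    IsMarkovKernel (κ ^ n) := by
  induction n with
  | zero => rw [pow_zero]; exact inferInstanceAs (IsMarkovKernel Kernel.id)
  | succ n ih => rw [pow_succ]; exact inferInstanceAs (IsMarkovKernel ((κ ^ n) ∘ₖ κ))

lemma iterate_kernelOp_eq {κ : Kernel E E} [IsMarkovKernel κ] {φ : E → ℝ}
    (h : UnitMeasurable φ) (n : ℕ) : (kernelOp κ)^[n] φ = kernelOp (κ ^ n) φ := by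
  induction n with
  | zero =>
    ext x
    change φ x = ∫ y, φ y ∂(Kernel.id x)
    rw [Kernel.id_apply, integral_dirac' _ _ h.1.stronglyMeasurable]
  | succ n ih =>
    ext x
    rw [Function.iterate_succ_apply', ih, pow_succ]
    exact (Kernel.integral_comp (κ := κ) (η := κ ^ n)
      (integrable_of_bounded h.1 h.2)).symm

/-- The weighted oscillation of `φ` is at most `L`. -/
def OscLE {E : Type*} (V : E → ℝ≥0) (β L : ℝ) (φ : E → ℝ) : Prop :=
  ∀ x y, |φ x - φ y| ≤ L * (2 + β * V x + β * V y)

/-- The weight splits as `(1 + β V x) + (1 + β V y)`, so `c = inf_y (φ y + L (1 + β V y))` works: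
one side is the definition of the infimum, the other is the oscillation bound. Boundedness of `φ`
makes the real infimum meaningful. -/
lemma OscLE.exists_center {E : Type*} {V : E → ℝ≥0} {β L : ℝ} (hβ : 0 ≤ β) (hL : 0 ≤ L) {φ : E → ℝ}
    (hφ : ∀ x, |φ x| ≤ 1) (h : OscLE V β L φ) : ∃ c, ∀ x, |φ x - c| ≤ L * (1 + β * V x) := by
  rcases isEmpty_or_nonempty E with hE | hE
  · exact ⟨0, fun x => hE.elim x⟩
  have hb : BddBelow (Set.range fun y => φ y + L * (1 + β * V y)) := by
    refine ⟨-1, ?_⟩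
    rintro _ ⟨y, rfl⟩
    have := (abs_le.1 (hφ y)).1
    have : 0 ≤ L * (1 + β * V y) := by positivity
    dsimp only
    linarith
  refine ⟨⨅ y, (φ y + L * (1 + β * V y)), fun x => abs_le.2 ⟨?_, ?_⟩⟩
  · linarith [ciInf_le hb x]
  · have : φ x - L * (1 + β * V x) ≤ ⨅ y, (φ y + L * (1 + β * V y)) := by
      refine le_ciInf fun y => ?_
      have := (abs_le.1 (h x y)).2
      linarith
    linarith

lemma integrable_of_drift {V : E → ℝ≥0} (hV : Measurable V) {μ : Measure E} {b : ℝ≥0}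
    (h : ∫⁻ y, (V y : ℝ≥0∞) ∂μ ≤ b) :
    Integrable (fun y => (V y : ℝ)) μ ∧ ∫ y, (V y : ℝ) ∂μ ≤ b := by
  have hi : Integrable (fun y => (V y : ℝ)) μ := by
    refine ⟨hV.coe_nnreal_real.aestronglyMeasurable, ?_⟩
    refine lt_of_le_of_lt ?_ (lt_of_le_of_lt h ENNReal.coe_lt_top)
    exact lintegral_mono fun y => by simp
  refine ⟨hi, ?_⟩
  rw [integral_eq_lintegral_of_nonneg_ae (ae_of_all _ fun y => (V y).coe_nonneg)
    hV.coe_nnreal_real.aestronglyMeasurable]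
  refine ENNReal.toReal_le_of_le_ofReal b.coe_nonneg ?_
  simpa using h

lemma abs_integral_le_weight {V : E → ℝ≥0} {μ : Measure E} [IsFiniteMeasure μ]
    (hV : Integrable (fun y => (V y : ℝ)) μ) {L β : ℝ} {ψ : E → ℝ}
    (h : ∀ x, |ψ x| ≤ L * (1 + β * V x)) :
    |∫ y, ψ y ∂μ| ≤ L * (μ.real Set.univ + β * ∫ y, (V y : ℝ) ∂μ) := by
  have h1 : Integrable (fun y => L * (1 + β * (V y : ℝ))) μ :=
    ((integrable_const _).add (hV.const_mul _)).const_mul _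
  have := norm_integral_le_of_norm_le (f := ψ) h1 (ae_of_all _ h)
  rw [integral_const_mul, integral_add (integrable_const _) (hV.const_mul _),
    integral_const_mul] at this
  simpa using this

/-- The oscillation bound for two points of a small set. -/
lemma abs_sub_le_of_minorization {V : E → ℝ≥0} (hV : Measurable V) {p q μ : Measure E}
    [IsProbabilityMeasure p] [IsProbabilityMeasure q] (hp : μ ≤ p) (hq : μ ≤ q) {a b : ℝ≥0}
    (ha : ∫⁻ y, (V y : ℝ≥0∞) ∂p ≤ a) (hb : ∫⁻ y, (V y : ℝ≥0∞) ∂q ≤ b)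
    {L β : ℝ} (hL : 0 ≤ L) (hβ : 0 ≤ β) {ψ : E → ℝ} (hψ : Measurable ψ)
    (h : ∀ x, |ψ x| ≤ L * (1 + β * V x)) :
    |∫ y, ψ y ∂p - ∫ y, ψ y ∂q| ≤ L * (2 * (1 - μ.real Set.univ) + β * a + β * b) := by
  -- The integral against the common part `μ` cancels in the difference; what remains of each
  -- measure is `r - μ`, of mass `1 - μ(E)`.
  have key : ∀ r : Measure E, IsProbabilityMeasure r → μ ≤ r → ∀ b : ℝ≥0,
      ∫⁻ y, (V y : ℝ≥0∞) ∂r ≤ b →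
      |∫ y, ψ y ∂r - ∫ y, ψ y ∂μ| ≤ L * ((1 - μ.real Set.univ) + β * b) := by
    intro r _ hr b hb
    have : IsFiniteMeasure μ := isFiniteMeasure_of_le r hr
    have hle : r - μ ≤ r := Measure.sub_le
    have : IsFiniteMeasure (r - μ) := isFiniteMeasure_of_le r hle
    have hs : r - μ + μ = r := Measure.sub_add_cancel_of_le hr
    obtain ⟨hVi, hVb⟩ := integrable_of_drift hV hb
    have hψi : Integrable ψ r := by
      refine Integrable.mono' (((integrable_const (1 : ℝ)).add (hVi.const_mul β)).const_mul L)
        hψ.aestronglyMeasurable (ae_of_all _ h)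
    have h1 : ∫ y, ψ y ∂r = ∫ y, ψ y ∂(r - μ) + ∫ y, ψ y ∂μ := by
      conv_lhs => rw [← hs]
      exact integral_add_measure (hψi.mono_measure hle) (hψi.mono_measure hr)
    have h2 : (r - μ).real Set.univ = 1 - μ.real Set.univ := by
      have : (r - μ + μ).real Set.univ = 1 := by rw [hs]; simp
      rw [measureReal_add_apply] at this
      linarith
    have h3 : ∫ y, (V y : ℝ) ∂(r - μ) ≤ b :=
      (integral_mono_measure hle (ae_of_all _ fun y => (V y).coe_nonneg) hVi).trans hVb
    rw [h1, add_sub_cancel_right]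
    refine (abs_integral_le_weight (hVi.mono_measure hle) h).trans ?_
    rw [h2]
    gcongr
  have e : ∫ y, ψ y ∂p - ∫ y, ψ y ∂q
      = (∫ y, ψ y ∂p - ∫ y, ψ y ∂μ) - (∫ y, ψ y ∂q - ∫ y, ψ y ∂μ) := by ring
  rw [e]
  refine (abs_sub _ _).trans ?_
  have := key p inferInstance hp a ha
  have := key q inferInstance hq b hb
  linarith

/-- `β` is small enough that `2βK ≤ a`, so the gain `2a` from minorization survives the drift
constant. With `ρ = 1 - η`, the first two bounds on `η` give the first inequality. The third bound
is the second inequality at `S = R`, and comparing slopes extends it to `S ≥ R`. -/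
lemma exists_contraction_constants {γ K R a : ℝ} (hγ0 : 0 ≤ γ) (hγ : γ < 1) (hK : 0 ≤ K)
    (hR : 2 * K < (1 - γ) * R) (ha : 0 < a) :
    ∃ β ρ : ℝ, 0 < β ∧ 0 < ρ ∧ ρ < 1 ∧
      (∀ S, 0 ≤ S → 2 * (1 - a) + β * (γ * S + 2 * K) ≤ ρ * (2 + β * S)) ∧
      (∀ S, R ≤ S → 2 + β * (γ * S + 2 * K) ≤ ρ * (2 + β * S)) := by
  have hR0 : 0 < R := by
    by_contra h
    nlinarith
  set β := a / (2 * K + 1) with hβ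
  have hβ0 : 0 < β := by positivity
  have hβK : 2 * (β * K) ≤ a := by
    have : β * (2 * K + 1) = a := by rw [hβ]; field_simp
    nlinarith
  set η := min (min (a / 2) ((1 - γ) / 2)) (β * ((1 - γ) * R - 2 * K) / (2 + β * R)) with hη
  have hη0 : 0 < η := by
    refine lt_min (lt_min (by positivity) (by linarith)) ?_
    have : 0 < (1 - γ) * R - 2 * K := by linarith
    positivity
  have h1 : η ≤ a / 2 := (min_le_left _ _).trans (min_le_left _ _)
  have h2 : η ≤ (1 - γ) / 2 := (min_le_left _ _).trans (min_le_right _ _)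
  have h3 : η * (2 + β * R) ≤ β * ((1 - γ) * R - 2 * K) := by
    have : 0 < 2 + β * R := by positivity
    exact (le_div_iff₀ this).1 (min_le_right _ _)
  refine ⟨β, 1 - η, hβ0, by linarith, by linarith, fun S hS => ?_, fun S hS => ?_⟩
  · have : η * (β * S) ≤ (1 - γ) * (β * S) := by
      have : 0 ≤ β * S := by positivity
      gcongr
      linarith
    nlinarith
  · have : 0 ≤ (1 - γ - η) * (β * (S - R)) := by
      have : 0 ≤ S - R := by linarith
      have : 0 ≤ 1 - γ - η := by linarith
      positivity
    nlinarith

/-- Harris' theorem in dual form: drift towards a small set makes a Markov kernel a contraction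
for a weighted oscillation seminorm, with constants that depend on the data only. -/
theorem exists_oscLE_contraction {γ K R a : ℝ≥0} (hγ : γ < 1)
    (hR : 2 * (K : ℝ) < (1 - γ) * R) (ha : 0 < a) :
    ∃ β ρ : ℝ, 0 < β ∧ 0 < ρ ∧ ρ < 1 ∧
      ∀ (V : E → ℝ≥0) (Q : Kernel E E) [IsMarkovKernel Q] (μ : Measure E), Measurable V →
        (∀ x, ∫⁻ y, (V y : ℝ≥0∞) ∂Q x ≤ (γ * V x + K : ℝ≥0)) →
        (∀ x, V x ≤ R → μ ≤ Q x) → (a : ℝ) ≤ μ.real Set.univ →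
        ∀ φ : E → ℝ, UnitMeasurable φ → ∀ L : ℝ, 0 ≤ L → OscLE V β L φ →
          OscLE V β (ρ * L) (kernelOp Q φ) := by
  obtain ⟨β, ρ, hβ, hρ0, hρ1, hs, hl⟩ := exists_contraction_constants γ.coe_nonneg (by exact_mod_cast hγ)
    K.coe_nonneg hR (a := a) (by exact_mod_cast ha)
  refine ⟨β, ρ, hβ, hρ0, hρ1, fun V Q _ μ hV hd hm hμ φ hφ L hL ho x y => ?_⟩
  obtain ⟨c, hc⟩ := ho.exists_center hβ.le hL hφ.2
  have hmeas : Measurable fun z => φ z - c := hφ.1.sub_const c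
  have hsub : kernelOp Q φ x - kernelOp Q φ y
      = ∫ z, (φ z - c) ∂Q x - ∫ z, (φ z - c) ∂Q y := by
    have : ∀ x, ∫ z, (φ z - c) ∂Q x = kernelOp Q φ x - c := fun x => by
      rw [integral_sub (integrable_of_bounded hφ.1 hφ.2) (integrable_const _)]
      simp [kernelOp]
    rw [this, this]
    ring
  rw [hsub]
  have hS0 : (0 : ℝ) ≤ V x + V y := by positivity
  by_cases hS : (R : ℝ) ≤ V x + V y
  -- Far out, the drift alone suffices: the minorizing measure is taken to be zero.
  · have h1 := abs_sub_le_of_minorization hV (Measure.zero_le (Q x)) (Measure.zero_le (Q y))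
      (hd x) (hd y) hL hβ.le hmeas hc
    refine h1.trans ?_
    have h2 := mul_le_mul_of_nonneg_left (hl _ hS) hL
    simp only [measureReal_zero, Pi.zero_apply, NNReal.coe_add, NNReal.coe_mul] at h1 ⊢
    nlinarith
  · push Not at hS
    have hx : V x ≤ R := by
      have : (V x : ℝ) ≤ R := by linarith [(V y).coe_nonneg]
      exact_mod_cast this
    have hy : V y ≤ R := by
      have : (V y : ℝ) ≤ R := by linarith [(V x).coe_nonneg]
      exact_mod_cast this
    have h1 := abs_sub_le_of_minorization hV (hm x hx) (hm y hy)
      (hd x) (hd y) hL hβ.le hmeas hc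
    refine h1.trans ?_
    have h2 := mul_le_mul_of_nonneg_left (hs _ hS0) hL
    have h3 := mul_le_mul_of_nonneg_left hμ hL
    simp only [NNReal.coe_add, NNReal.coe_mul] at h1 ⊢
    nlinarith

end Harris

/-! ### Drift and minorization for powers of a kernel. -/

section KernelPowers

variable {E : Type*} [MeasurableSpace E]

/-- Only one factor `γ` is kept; the other steps use `γ ≤ 1`, and each step adds `K`. -/
lemma lintegral_pow_succ_le_of_drift {κ : Kernel E E} [IsMarkovKernel κ] {V : E → ℝ≥0}
    (hV : Measurable V) {γ K : ℝ≥0} (hγ : γ ≤ 1)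
    (h : ∀ x, ∫⁻ y, (V y : ℝ≥0∞) ∂κ x ≤ (γ * V x + K : ℝ≥0)) (n : ℕ) (x : E) :
    ∫⁻ y, (V y : ℝ≥0∞) ∂(κ ^ (n + 1)) x ≤ (γ * V x + (n + 1) * K : ℝ≥0) := by
  induction n with
  | zero => simpa using h x
  | succ n ih =>
    rw [pow_succ' κ]
    change ∫⁻ y, (V y : ℝ≥0∞) ∂(κ ∘ₖ (κ ^ (n + 1))) x ≤ _
    rw [Kernel.lintegral_comp _ _ _ hV.coe_nnreal_ennreal]
    calc ∫⁻ y, ∫⁻ z, (V z : ℝ≥0∞) ∂κ y ∂(κ ^ (n + 1)) x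
        ≤ ∫⁻ y, ((V y : ℝ≥0∞) + K) ∂(κ ^ (n + 1)) x := by
          refine lintegral_mono fun y => (h y).trans ?_
          norm_cast
          gcongr
          exact mul_le_of_le_one_left' hγ
      _ ≤ (γ * V x + (n + 1) * K : ℝ≥0) + K := by
          rw [lintegral_add_right _ measurable_const]
          simpa using ih
      _ = _ := by
          push_cast
          ring

/-- The minorant never leaves `B`, so the comparison can be iterated although `κ` itself may leave
`B`. -/
lemma pow_le_pow_of_minorization {κ S : Kernel E E} {B : Set E}
    (hle : ∀ x ∈ B, S x ≤ κ x) (hB : ∀ x ∈ B, ∀ᵐ y ∂S x, y ∈ B) (n : ℕ) :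
    ∀ x ∈ B, (S ^ n) x ≤ (κ ^ n) x := by
  induction n with
  | zero => intro x _; simp
  | succ n ih =>
    intro x hx
    rw [pow_succ, pow_succ, Measure.le_iff]
    intro A hA
    change ((S ^ n) ∘ₖ S) x A ≤ ((κ ^ n) ∘ₖ κ) x A
    rw [Kernel.comp_apply' _ _ _ hA, Kernel.comp_apply' _ _ _ hA]
    calc ∫⁻ y, (S ^ n) y A ∂S x ≤ ∫⁻ y, (κ ^ n) y A ∂S x := by
          refine lintegral_mono_ae ?_
          filter_upwards [hB x hx] with y hy using ih y hy A
      _ ≤ ∫⁻ y, (κ ^ n) y A ∂κ x := lintegral_mono' (hle x hx) le_rfl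

end KernelPowers

/-! ### The autoregressive kernel and its minorization. -/

section AutoregressiveKernel

variable {d : ℕ}

/-- The vector `(y, x 0, x 1, …, x (d - 2))`. -/
def push (x : Fin d → ℝ) (y : ℝ) : Fin d → ℝ :=
  fun i => if (i : ℕ) = 0 then y else x ⟨i - 1, by omega⟩

lemma measurable_push : Measurable fun p : (Fin d → ℝ) × ℝ => push p.1 p.2 := by
  refine measurable_pi_lambda _ fun i => ?_
  unfold push
  split_ifs
  · exact measurable_snd
  · exact (measurable_pi_apply _).comp measurable_fst

/-- The kernel that sends `x` to the law of `push x (f x + z)` with `z` of law `μ`. -/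
def pushKernel (f : (Fin d → ℝ) → ℝ) (μ : Measure ℝ) [SFinite μ] :
    Kernel (Fin d → ℝ) (Fin d → ℝ) :=
  (Kernel.id ×ₖ Kernel.const _ μ).map fun p => push p.1 (f p.1 + p.2)

variable {f : (Fin d → ℝ) → ℝ} {μ : Measure ℝ} [SFinite μ]

lemma measurable_push_add (hf : Measurable f) :
    Measurable fun p : (Fin d → ℝ) × ℝ => push p.1 (f p.1 + p.2) :=
  measurable_push.comp (measurable_fst.prodMk ((hf.comp measurable_fst).add measurable_snd))

lemma measurable_push_add_right (hf : Measurable f) (x : Fin d → ℝ) :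
    Measurable fun z => push x (f x + z) :=
  (measurable_push_add hf).comp measurable_prodMk_left

lemma pushKernel_apply (hf : Measurable f) (x : Fin d → ℝ) :
    pushKernel f μ x = μ.map fun z => push x (f x + z) := by
  rw [pushKernel, Kernel.map_apply _ (measurable_push_add hf), Kernel.prod_apply, Kernel.id_apply,
    Kernel.const_apply, Measure.dirac_prod, Measure.map_map (measurable_push_add hf)
    measurable_prodMk_left]
  rfl

lemma isMarkovKernel_pushKernel (hf : Measurable f) [IsProbabilityMeasure μ] :
    IsMarkovKernel (pushKernel f μ) :=
  Kernel.IsMarkovKernel.map _ (measurable_push_add hf)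

lemma lintegral_pushKernel (hf : Measurable f) (x : Fin d → ℝ) {g : (Fin d → ℝ) → ℝ≥0∞}
    (hg : Measurable g) : ∫⁻ y, g y ∂pushKernel f μ x = ∫⁻ z, g (push x (f x + z)) ∂μ := by
  rw [pushKernel_apply hf, lintegral_map hg (measurable_push_add_right hf x)]

lemma kernelOp_pushKernel (hf : Measurable f) (x : Fin d → ℝ) {g : (Fin d → ℝ) → ℝ}
    (hg : Measurable g) : kernelOp (pushKernel f μ) g x = ∫ z, g (push x (f x + z)) ∂μ := by
  rw [kernelOp, pushKernel_apply hf, integral_map (measurable_push_add_right hf x).aemeasurable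
    hg.aestronglyMeasurable]

/-- With constant `f`, each step inserts a coordinate whose law ignores the state and shifts the old
ones; after `n` steps only the coordinates with `i + n < d` survive, and none for `n = d`. -/
lemma pow_pushKernel_apply_congr (hf : ∀ x y, f x = f y) (hfm : Measurable f)
    {A : Set (Fin d → ℝ)} (hA : MeasurableSet A) (n : ℕ) :
    ∀ x y : Fin d → ℝ, (∀ i : Fin d, (i : ℕ) + n < d → x i = y i) →
      (pushKernel f μ ^ n) x A = (pushKernel f μ ^ n) y A := by
  induction n with
  | zero =>
    intro x y h
    rw [show x = y from funext fun i => h i (by omega)]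
  | succ n ih =>
    intro x y h
    rw [pow_succ]
    change ((pushKernel f μ ^ n) ∘ₖ pushKernel f μ) x A = ((pushKernel f μ ^ n) ∘ₖ pushKernel f μ) y A
    rw [Kernel.comp_apply' _ _ _ hA, Kernel.comp_apply' _ _ _ hA,
      lintegral_pushKernel hfm _ (Kernel.measurable_coe _ hA),
      lintegral_pushKernel hfm _ (Kernel.measurable_coe _ hA)]
    refine lintegral_congr fun z => ih _ _ fun i hi => ?_
    unfold push
    split_ifs with h0
    · rw [hf x y]
    · exact h _ (by simp only; omega)

lemma pow_pushKernel_apply_univ (hf : Measurable f) (n : ℕ) (x : Fin d → ℝ) :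
    (pushKernel f μ ^ n) x Set.univ = μ Set.univ ^ n := by
  induction n generalizing x with
  | zero => simp only [pow_zero]; exact measure_univ (μ := Kernel.id x)
  | succ n ih =>
    rw [pow_succ]
    change ((pushKernel f μ ^ n) ∘ₖ pushKernel f μ) x Set.univ = _
    rw [Kernel.comp_apply' _ _ _ MeasurableSet.univ]
    simp_rw [ih]
    rw [lintegral_const, pushKernel_apply hf,
      Measure.map_apply (measurable_push_add_right hf x) MeasurableSet.univ, Set.preimage_univ,
      pow_succ]

/-- For `y ∈ [-1, 1]` the distance `|y - x|` is at most `1 + M`, so the density at `y` is at least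
the standard one at `1 + M`. -/
lemma smul_restrict_le_gaussianReal {M x : ℝ} (hx : |x| ≤ M) :
    gaussianPDF 0 1 (1 + M) • volume.restrict (Set.Icc (-1) 1) ≤ gaussianReal x 1 := by
  rw [gaussianReal_of_var_ne_zero x one_ne_zero, ← withDensity_const,
    ← withDensity_indicator measurableSet_Icc]
  refine withDensity_mono (ae_of_all _ fun y => ?_)
  by_cases hy : y ∈ Set.Icc (-1 : ℝ) 1
  · rw [Set.indicator_of_mem hy]
    refine ENNReal.ofReal_le_ofReal ?_
    have key : (y - x) ^ 2 ≤ (1 + M - 0) ^ 2 := by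
      have := abs_le.1 hx
      refine sq_le_sq.2 ?_
      rw [abs_of_nonneg (by linarith [abs_nonneg x] : 0 ≤ 1 + M - 0)]
      exact abs_le.2 ⟨by linarith [hy.1], by linarith [hy.2]⟩
    simp only [gaussianPDFReal]
    gcongr
  · rw [Set.indicator_of_notMem hy]
    exact zero_le

/-- A minorization of the `d`-step autoregressive kernel, uniform in the regression function. -/
lemma exists_minorization (d : ℕ) {r M : ℝ} (hr : 1 ≤ r) :
    ∃ (ν : Measure (Fin d → ℝ)) (a : ℝ≥0), 0 < a ∧ ν.real Set.univ = a ∧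
      ∀ f : (Fin d → ℝ) → ℝ, Measurable f → (∀ x, (∀ i, |x i| ≤ r) → |f x| ≤ M) →
        ∀ x, (∀ i, |x i| ≤ r) → ν ≤ (pushKernel f (gaussianReal 0 1) ^ d) x := by
  set δ : ℝ≥0∞ := gaussianPDF 0 1 (1 + M) with hδ
  set μ : Measure ℝ := δ • volume.restrict (Set.Icc (-1) 1) with hμ
  have hfin : IsFiniteMeasure μ := by
    refine ⟨?_⟩
    rw [hμ, Measure.smul_apply, smul_eq_mul]
    exact ENNReal.mul_lt_top gaussianPDF_lt_top (measure_lt_top _ _)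
  have hμ0 : μ Set.univ ≠ 0 := by
    rw [hμ, Measure.smul_apply, smul_eq_mul, Measure.restrict_apply_univ, Real.volume_Icc]
    refine mul_ne_zero (gaussianPDF_pos _ one_ne_zero _).ne' ?_
    norm_num
  let S := pushKernel (d := d) 0 μ
  have hS0 : Measurable (0 : (Fin d → ℝ) → ℝ) := measurable_zero
  -- The starting point `0` is arbitrary: `S ^ d` has forgotten its start.
  refine ⟨(S ^ d) 0, (μ Set.univ ^ d).toNNReal, ?_, ?_, fun f hf hM x hx => ?_⟩
  · refine ENNReal.toNNReal_pos (pow_ne_zero _ hμ0) (by simp)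
  · rw [measureReal_def, pow_pushKernel_apply_univ hS0]
    rfl
  · have h1 : (S ^ d) 0 = (S ^ d) x := by
      ext A hA
      exact pow_pushKernel_apply_congr (fun _ _ => rfl) hS0 hA d _ _ fun i hi => by omega
    rw [h1]
    -- Fresh coordinates of `S` lie in `[-1, 1]`, hence in the box because `1 ≤ r`.
    refine pow_le_pow_of_minorization (B := {x : Fin d → ℝ | ∀ i, |x i| ≤ r}) (fun y hy => ?_)
      (fun y hy => ?_) d x hx
    · have hp : Measurable (push y) := measurable_push.comp measurable_prodMk_left
      have e : pushKernel f (gaussianReal 0 1) y = (gaussianReal (f y) 1).map (push y) := by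
        rw [pushKernel_apply hf, ← zero_add (f y), ← gaussianReal_map_const_add (f y),
          Measure.map_map hp (by fun_prop)]
        simp [Function.comp_def]
      have e' : S y = μ.map (push y) := by
        simp only [S]
        rw [pushKernel_apply hS0]
        simp
      rw [e, e']
      exact Measure.map_mono (smul_restrict_le_gaussianReal (hM y hy)) hp
    · simp only [S]
      rw [pushKernel_apply hS0]
      refine (ae_map_iff (measurable_push_add_right hS0 y).aemeasurable ?_).2 ?_
      · simp only [Set.ofPred_forall]
        exact MeasurableSet.iInter fun i => measurableSet_le
          (measurable_pi_apply i).abs measurable_const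
      · have hz : ∀ᵐ z ∂μ, z ∈ Set.Icc (-1 : ℝ) 1 :=
          Measure.ae_smul_measure (ae_restrict_mem measurableSet_Icc) _
        filter_upwards [hz] with z hz i
        unfold push
        split_ifs
        · simpa using (abs_le.2 hz).trans hr
        · exact hy _

end AutoregressiveKernel

/-! ### The Lyapunov function. -/

section Lyapunov

variable {d : ℕ}

/-- The weighted sum of the absolute values of the coordinates. -/
def weightedNorm (w : ℕ → ℝ≥0) (x : Fin d → ℝ) : ℝ≥0 := ∑ i : Fin d, w i * ‖x i‖₊

lemma measurable_weightedNorm (w : ℕ → ℝ≥0) : Measurable (weightedNorm (d := d) w) := by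
  unfold weightedNorm
  fun_prop

/-- The shift discards the oldest coordinate; `w d = 0` lets the sum still run over all of `Fin d`.
-/
lemma weightedNorm_push (hd : 1 ≤ d) {w : ℕ → ℝ≥0} (hw : w d = 0) (x : Fin d → ℝ) (y : ℝ) :
    weightedNorm w (push x y) = w 0 * ‖y‖₊ + ∑ i : Fin d, w (i + 1) * ‖x i‖₊ := by
  obtain ⟨e, rfl⟩ : ∃ e, d = e + 1 := ⟨d - 1, by omega⟩
  rw [weightedNorm, Fin.sum_univ_succ, Fin.sum_univ_castSucc (n := e)]
  simp only [push, Fin.val_last, hw, zero_mul, add_zero]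
  simp
  rfl

/-- Spread the slack `1 - ∑ c` evenly as `ε` and take the tail sums `w i = ∑_{j ≥ i} (c j + ε)`.
Then `w 0 = 1` and `w 0 * c i + w (i + 1) = w i - ε ≤ (1 - ε) w i`, since `w i ≤ 1`. -/
lemma exists_weights (hd : 1 ≤ d) {c : Fin d → ℝ≥0} (hc : ∑ i, c i < 1) :
    ∃ (w : ℕ → ℝ≥0) (γ : ℝ≥0), γ < 1 ∧ w d = 0 ∧ (∀ i : Fin d, 0 < w i) ∧
      ∀ i : Fin d, w 0 * c i + w (i + 1) ≤ γ * w i := by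
  set ε : ℝ≥0 := (1 - ∑ i, c i) / d with hε
  have hd0 : (0 : ℝ≥0) < d := by exact_mod_cast hd
  have hε0 : 0 < ε := div_pos (tsub_pos_of_lt hc) hd0
  let b : ℕ → ℝ≥0 := fun i => if h : i < d then c ⟨i, h⟩ + ε else 0
  let w : ℕ → ℝ≥0 := fun i => ∑ j ∈ Finset.Ico i d, b j
  have hw0 : w 0 = 1 := by
    simp only [w, ← Finset.range_eq_Ico]
    rw [Finset.sum_range]
    simp only [b, Fin.is_lt, dite_true, Fin.eta, Finset.sum_add_distrib, Finset.sum_const,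
      Finset.card_univ, Fintype.card_fin, nsmul_eq_mul]
    rw [hε, mul_div_cancel₀ _ hd0.ne', add_tsub_cancel_of_le hc.le]
  have hstep : ∀ i : Fin d, w i = c i + ε + w (i + 1) := fun i => by
    simp only [w]
    rw [Finset.sum_eq_sum_Ico_succ_bot i.2]
    simp [b]
  have hw1 : ∀ i, w i ≤ 1 := fun i => by
    rw [← hw0]
    exact Finset.sum_le_sum_of_subset (Finset.Ico_subset_Ico_left (Nat.zero_le i))
  have hε1 : ε ≤ 1 := by
    have := hstep ⟨0, hd⟩
    have h := hw1 0
    rw [this] at h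
    exact le_trans (le_trans le_add_self le_self_add) h
  refine ⟨w, 1 - ε, tsub_lt_self one_pos hε0, by simp [w], fun i => ?_, fun i => ?_⟩
  · rw [hstep i]; positivity
  · rw [tsub_mul, one_mul, hw0, one_mul]
    refine le_tsub_of_add_le_right ?_
    calc c i + w (i + 1) + ε * w i ≤ c i + w (i + 1) + ε * 1 := by gcongr; exact hw1 _
      _ = w i := by rw [hstep i]; ring

lemma weightedNorm_push_le (hd : 1 ≤ d) {w : ℕ → ℝ≥0} {γ c0 : ℝ≥0} {c : Fin d → ℝ≥0}
    (hw : w d = 0) (h : ∀ i : Fin d, w 0 * c i + w (i + 1) ≤ γ * w i) {m : (Fin d → ℝ) → ℝ}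
    (hm : ∀ x, ‖m x‖₊ ≤ c0 + ∑ i, c i * ‖x i‖₊) (x : Fin d → ℝ) (z : ℝ) :
    weightedNorm w (push x (m x + z)) ≤ γ * weightedNorm w x + w 0 * c0 + w 0 * ‖z‖₊ := by
  rw [weightedNorm_push hd hw]
  calc w 0 * ‖m x + z‖₊ + ∑ i : Fin d, w (i + 1) * ‖x i‖₊
      ≤ w 0 * ((c0 + ∑ i, c i * ‖x i‖₊) + ‖z‖₊) + ∑ i : Fin d, w (i + 1) * ‖x i‖₊ := by
        gcongr
        exact (nnnorm_add_le _ _).trans (by gcongr; exact hm x)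
    _ = ∑ i : Fin d, (w 0 * c i + w (i + 1)) * ‖x i‖₊ + w 0 * c0 + w 0 * ‖z‖₊ := by
        simp only [add_mul, Finset.sum_add_distrib, mul_add, Finset.mul_sum, mul_assoc]
        ring
    _ ≤ ∑ i : Fin d, γ * w i * ‖x i‖₊ + w 0 * c0 + w 0 * ‖z‖₊ := by
        gcongr with i
        exact h i
    _ = _ := by simp only [weightedNorm, Finset.mul_sum, mul_assoc]

/-- The drift constant. -/
def driftConst (w0 c0 : ℝ≥0) : ℝ≥0 :=
  w0 * c0 + w0 * (∫⁻ z, (‖z‖₊ : ℝ≥0∞) ∂gaussianReal 0 1).toNNReal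

lemma lintegral_weightedNorm_push_le (hd : 1 ≤ d) {w : ℕ → ℝ≥0} {γ c0 : ℝ≥0} {c : Fin d → ℝ≥0}
    (hw : w d = 0) (h : ∀ i : Fin d, w 0 * c i + w (i + 1) ≤ γ * w i) {m : (Fin d → ℝ) → ℝ}
    (hm : ∀ x, ‖m x‖₊ ≤ c0 + ∑ i, c i * ‖x i‖₊) (x : Fin d → ℝ) :
    ∫⁻ z, (weightedNorm w (push x (m x + z)) : ℝ≥0∞) ∂gaussianReal 0 1 ≤
      (γ * weightedNorm w x + driftConst (w 0) c0 : ℝ≥0) := by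
  have hfin : ∫⁻ z, (‖z‖₊ : ℝ≥0∞) ∂gaussianReal 0 1 ≠ ∞ := by
    have := ((memLp_id_gaussianReal (μ := 0) (v := 1) 1).integrable (by simp)).2
    exact this.ne
  calc ∫⁻ z, (weightedNorm w (push x (m x + z)) : ℝ≥0∞) ∂gaussianReal 0 1
      ≤ ∫⁻ z, (((γ * weightedNorm w x + w 0 * c0 : ℝ≥0) : ℝ≥0∞) + w 0 * ‖z‖₊)
          ∂gaussianReal 0 1 := by
        refine lintegral_mono fun z => ?_
        rw [← ENNReal.coe_mul, ← ENNReal.coe_add, ENNReal.coe_le_coe]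
        exact weightedNorm_push_le hd hw h hm x z
    _ = _ := by
        rw [lintegral_add_left measurable_const, lintegral_const_mul _ (by fun_prop)]
        simp only [lintegral_const, measure_univ, mul_one, driftConst, ENNReal.coe_add,
          ENNReal.coe_mul, ENNReal.coe_toNNReal hfin]
        ring

lemma exists_box (w : ℕ → ℝ≥0) (hw : ∀ i : Fin d, 0 < w i) (R : ℝ≥0) :
    ∃ r : ℝ, 1 ≤ r ∧ ∀ x : Fin d → ℝ, weightedNorm w x ≤ R → ∀ i, |x i| ≤ r := by
  refine ⟨1 + ∑ i : Fin d, (R / w i : ℝ≥0), ?_, fun x hx i => ?_⟩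
  · exact le_add_of_nonneg_right (by positivity)
  have h1 : w i * ‖x i‖₊ ≤ R :=
    (Finset.single_le_sum (f := fun i : Fin d => w i * ‖x i‖₊) (fun _ _ => zero_le)
      (Finset.mem_univ i)).trans hx
  have h2 : ‖x i‖₊ ≤ R / w i := by
    rw [le_div_iff₀ (hw i), mul_comm]
    exact h1
  have h3 : R / w i ≤ ∑ i : Fin d, R / w i :=
    Finset.single_le_sum (f := fun i : Fin d => R / w i) (fun _ _ => zero_le)
      (Finset.mem_univ i)
  have h4 : ‖x i‖₊ ≤ 1 + ∑ i : Fin d, R / w i := (h2.trans h3).trans le_add_self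
  exact_mod_cast h4

end Lyapunov

/-! ### Regrouping independent variables. -/

section Independence

variable {Ω : Type*} [mΩ : MeasurableSpace Ω] {P : Measure Ω}

/-- Both hypotheses together make the joint law a triple product, which is then reassociated. -/
lemma indepFun_prodMk_left_of_indepFun_prodMk_right [IsProbabilityMeasure P] {α β γ : Type*}
    [MeasurableSpace α] [MeasurableSpace β] [MeasurableSpace γ] {X : Ω → α} {Y : Ω → β} {Z : Ω → γ}
    (hX : Measurable X) (hY : Measurable Y) (hZ : Measurable Z)
    (h : IndepFun X (fun ω => (Y ω, Z ω)) P) (h' : IndepFun Y Z P) :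
    IndepFun (fun ω => (X ω, Y ω)) Z P := by
  have e1 := (indepFun_iff_map_prod_eq_prod_map_map hX.aemeasurable
    (hY.prodMk hZ).aemeasurable).1 h
  have e2 := (indepFun_iff_map_prod_eq_prod_map_map hY.aemeasurable hZ.aemeasurable).1 h'
  have hXY : IndepFun X Y P := h.comp measurable_id measurable_fst
  have e3 := (indepFun_iff_map_prod_eq_prod_map_map hX.aemeasurable hY.aemeasurable).1 hXY
  have : IsProbabilityMeasure (P.map X) := Measure.isProbabilityMeasure_map hX.aemeasurable
  have : IsProbabilityMeasure (P.map Y) := Measure.isProbabilityMeasure_map hY.aemeasurable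
  have : IsProbabilityMeasure (P.map Z) := Measure.isProbabilityMeasure_map hZ.aemeasurable
  refine (indepFun_iff_map_prod_eq_prod_map_map (hX.prodMk hY).aemeasurable hZ.aemeasurable).2 ?_
  rw [e3]
  refine (MeasurableEquiv.prodAssoc (α := α) (β := β) (γ := γ)).map_measurableEquiv_injective ?_
  rw [Measure.prodAssoc_prod, ← e2, ← e1, Measure.map_map (MeasurableEquiv.measurable _)
    ((hX.prodMk hY).prodMk hZ)]
  rfl

end Independence

/-! ### Integrating out an innovation on a past event. -/

section PastEvents

variable {Ω : Type*} {𝓕 : MeasurableSpace Ω} [mΩ : MeasurableSpace Ω] {P : Measure Ω}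

/-- On a past event, the joint law of a past variable and an independent innovation is a product. -/
lemma map_restrict_prodMk_of_indep [IsProbabilityMeasure P] (h𝓕 : 𝓕 ≤ mΩ)
    {S : Type*} [MeasurableSpace S] {Z : Ω → S} (hZ : Measurable[𝓕] Z) {v : Ω → ℝ}
    (hv : Measurable v) (h : Indep 𝓕 (MeasurableSpace.comap v inferInstance) P) {A : Set Ω}
    (hA : MeasurableSet[𝓕] A) :
    (P.restrict A).map (fun ω => (Z ω, v ω)) = ((P.restrict A).map Z).prod (P.map v) := by
  have hZm : Measurable Z := hZ.mono h𝓕 le_rfl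
  have : IsProbabilityMeasure (P.map v) := Measure.isProbabilityMeasure_map hv.aemeasurable
  refine (Measure.prod_eq fun s t hs ht => ?_).symm
  rw [Measure.map_apply (hZm.prodMk hv) (hs.prod ht), Measure.map_apply hZm hs,
    Measure.map_apply hv ht, Measure.restrict_apply ((hZm.prodMk hv) (hs.prod ht)),
    Measure.restrict_apply (hZm hs)]
  have := (Indep_iff _ _ P).1 h (Z ⁻¹' s ∩ A) (v ⁻¹' t) (MeasurableSet.inter (hZ hs) hA)
    ⟨t, ht, rfl⟩
  rw [← this]
  congr 1
  ext ω
  simp only [Set.mem_inter_iff, Set.mem_preimage, Set.mem_prod]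
  tauto

lemma setIntegral_eq_setIntegral_of_indep [IsProbabilityMeasure P]
    (h𝓕 : 𝓕 ≤ mΩ) {S : Type*} [MeasurableSpace S] {Z : Ω → S} (hZ : Measurable[𝓕] Z) {v : Ω → ℝ}
    (hv : Measurable v) (h : Indep 𝓕 (MeasurableSpace.comap v inferInstance) P) {A : Set Ω}
    (hA : MeasurableSet[𝓕] A) {F : S × ℝ → ℝ} (hF : Measurable F) (hb : ∀ p, |F p| ≤ 1) :
    ∫ ω in A, F (Z ω, v ω) ∂P = ∫ ω in A, ∫ z, F (Z ω, z) ∂(P.map v) ∂P := by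
  have hZm : Measurable Z := hZ.mono h𝓕 le_rfl
  have : IsProbabilityMeasure (P.map v) := Measure.isProbabilityMeasure_map hv.aemeasurable
  rw [← integral_map (φ := fun ω => (Z ω, v ω)) (hZm.prodMk hv).aemeasurable
    hF.aestronglyMeasurable, map_restrict_prodMk_of_indep h𝓕 hZ hv h hA,
    integral_prod _ (integrable_of_bounded hF hb),
    integral_map hZm.aemeasurable
      hF.stronglyMeasurable.integral_prod_right'.aestronglyMeasurable]

lemma lintegral_eq_lintegral_of_indep [IsProbabilityMeasure P]
    (h𝓕 : 𝓕 ≤ mΩ) {S : Type*} [MeasurableSpace S] {Z : Ω → S} (hZ : Measurable[𝓕] Z) {v : Ω → ℝ}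
    (hv : Measurable v) (h : Indep 𝓕 (MeasurableSpace.comap v inferInstance) P)
    {F : S × ℝ → ℝ≥0∞} (hF : Measurable F) :
    ∫⁻ ω, F (Z ω, v ω) ∂P = ∫⁻ ω, ∫⁻ z, F (Z ω, z) ∂(P.map v) ∂P := by
  have hZm : Measurable Z := hZ.mono h𝓕 le_rfl
  have : IsProbabilityMeasure (P.map v) := Measure.isProbabilityMeasure_map hv.aemeasurable
  have e := map_restrict_prodMk_of_indep h𝓕 hZ hv h (A := Set.univ) MeasurableSet.univ
  rw [Measure.restrict_univ] at e
  rw [← lintegral_map (g := fun ω => (Z ω, v ω)) hF (hZm.prodMk hv), e,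
    lintegral_prod _ hF.aemeasurable, lintegral_map hF.lintegral_prod_right' hZm]

end PastEvents

/-! ### The Markov property and moments of the process. -/

section Autoregression

variable {Ω : Type*} [mΩ : MeasurableSpace Ω] {P : Measure Ω} {d T : ℕ}
  {ν : Measure (Fin d → ℝ)} {m : (Fin d → ℝ) → ℝ} {Y v : ℤ → Ω → ℝ}

omit mΩ in
lemma measurable_sigmaField {a b s : ℤ} (hs : s ∈ Set.Icc a b) :
    Measurable[sigmaField Y a b] (Y s) := by
  have h : MeasurableSpace.comap (Y s) (borel ℝ) ≤ sigmaField Y a b :=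
    le_iSup₂ (f := fun s (_ : s ∈ Set.Icc a b) => MeasurableSpace.comap (Y s) (borel ℝ)) s hs
  exact fun A hA => h _ ⟨A, hA, rfl⟩

omit mΩ in
lemma sigmaField_mono {a b a' b' : ℤ} (h1 : a' ≤ a) (h2 : b ≤ b') :
    sigmaField Y a b ≤ sigmaField Y a' b' :=
  biSup_mono fun _ hs => ⟨h1.trans hs.1, hs.2.trans h2⟩

lemma IsNonlinearAR.sigmaField_le (h : IsNonlinearAR P d T ν m Y v) {u : ℤ} (hu : u ≤ T) :
    sigmaField Y (1 - d) u ≤ mΩ :=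
  iSup₂_le fun s hs => (h.measurable_Y s ⟨hs.1, hs.2.trans hu⟩).comap_le

omit mΩ in
lemma measurable_lagVector {u : ℤ} (hu : 0 ≤ u) :
    Measurable[sigmaField Y (1 - d) u] (lagVector d Y (u + 1)) := by
  refine @measurable_pi_lambda _ _ _ (_) _ _ fun i => ?_
  exact measurable_sigmaField ⟨by have := i.2; omega, by omega⟩

lemma IsNonlinearAR.measurable_lagVector_one (h : IsNonlinearAR P d T ν m Y v) :
    Measurable (lagVector d Y 1) :=
  (measurable_lagVector (u := 0) le_rfl).mono (h.sigmaField_le (by positivity)) le_rfl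

/-- Up to null sets, the process is a measurable function of the initial vector and of the
preceding innovations. -/
lemma IsNonlinearAR.exists_representation (h : IsNonlinearAR P d T ν m Y v) (hm : Measurable m)
    {u : ℤ} (hu : u ≤ T) (J : Finset (Set.Icc (1 : ℤ) T)) (hJ : ∀ i, i ∈ J ↔ (i : ℤ) < u) (n : ℕ) :
    ∀ s : ℤ, 1 - d ≤ s → s < 1 - d + n → s < u →
      ∃ g : (Fin d → ℝ) × (J → ℝ) → ℝ, Measurable g ∧
        ∀ᵐ ω ∂P, Y s ω = g (lagVector d Y 1 ω, fun i : J => v i ω) := by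
  induction n with
  | zero => intro s h1 h2; omega
  | succ n ih =>
    intro s h1 h2 hsu
    by_cases hs : s ≤ 0
    -- Coordinate `i` of the initial vector is `Y (-i)`.
    · refine ⟨fun p => p.1 ⟨(-s).toNat, by omega⟩, by fun_prop, ae_of_all _ fun ω => ?_⟩
      simp only [lagVector]
      congr
      omega
    · have hs1 : s ∈ Set.Icc (1 : ℤ) T := ⟨by omega, by omega⟩
      choose g hgm hg using fun i : Fin d =>
        ih (s - 1 - (i : ℕ)) (by have := i.2; omega) (by omega) (by omega)
      refine ⟨fun p => m (fun i => g i p) + p.2 ⟨⟨s, hs1⟩, (hJ _).2 hsu⟩, ?_, ?_⟩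
      · exact (hm.comp (measurable_pi_lambda _ hgm)).add (by fun_prop)
      · filter_upwards [h.recursion s hs1, ae_all_iff.2 hg] with ω h1 h2
        rw [h1]
        congr 2
        exact funext h2

/-- The past is a.e. a function of the initial vector and the earlier innovations, which are jointly
independent of `v u`. As the recursion holds only almost everywhere, independence is proved for the
representing functions and then transferred to `Y`. -/
lemma IsNonlinearAR.indep_past [IsProbabilityMeasure P] (h : IsNonlinearAR P d T ν m Y v)
    (hm : Measurable m) {u : ℤ} (hu : u ∈ Set.Icc (1 : ℤ) T) :
    Indep (sigmaField Y (1 - d) (u - 1)) (MeasurableSpace.comap (v u) inferInstance) P := by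
  classical
  let J : Finset (Set.Icc (1 : ℤ) T) := Finset.univ.filter fun i => (i : ℤ) < u
  let J' : Finset (Set.Icc (1 : ℤ) T) := {⟨u, hu⟩}
  have hJ : ∀ i, i ∈ J ↔ (i : ℤ) < u := fun i => by simp [J]
  have hdisj : Disjoint J J' := by
    rw [Finset.disjoint_singleton_right, hJ]
    exact lt_irrefl u
  have hvm : ∀ i : Set.Icc (1 : ℤ) T, Measurable (v i) := fun i => h.measurable_v i i.2
  have h1 := h.iIndepFun_v.indepFun_finset J J' hdisj hvm
  have h2 : IndepFun (lagVector d Y 1)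
      (fun ω => ((fun i : J => v i ω), (fun i : J' => v i ω))) P :=
    h.indepFun_init.comp (φ := id) measurable_id
      (ψ := fun w : Set.Icc (1 : ℤ) T → ℝ => ((fun i : J => w i), (fun i : J' => w i)))
      (by fun_prop)
  have h3 := indepFun_prodMk_left_of_indepFun_prodMk_right h.measurable_lagVector_one
    (measurable_pi_lambda _ fun i : J => hvm i) (measurable_pi_lambda _ fun i : J' => hvm i) h2 h1
  choose g hgm hg using fun s : Set.Icc (1 - (d : ℤ)) (u - 1) =>
    h.exists_representation hm hu.2 J hJ ((s : ℤ) - (1 - d) + 1).toNat s s.2.1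
      (by have := s.2.1; omega) (by have := s.2.2; omega)
  have h4 : IndepFun (fun ω (s : Set.Icc (1 - (d : ℤ)) (u - 1)) => Y s ω) (v u) P := by
    have hψ : Measurable fun w : J' → ℝ => w ⟨⟨u, hu⟩, Finset.mem_singleton_self _⟩ :=
      measurable_pi_apply _
    have h5 := h3.comp (φ := fun p s => g s p) (measurable_pi_lambda _ hgm) hψ
    refine h5.congr ?_ Filter.EventuallyEq.rfl
    filter_upwards [ae_all_iff.2 hg] with ω hω
    exact funext fun s => (hω s).symm
  refine indep_of_indep_of_le_left h4 (iSup₂_le fun s hs => ?_)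
  rintro _ ⟨A, hA, rfl⟩
  exact ⟨(fun w => w ⟨s, hs⟩) ⁻¹' A, measurable_pi_apply _ hA, rfl⟩

lemma IsNonlinearAR.lagVector_succ (h : IsNonlinearAR P d T ν m Y v) {u : ℤ}
    (hu : u ∈ Set.Icc (1 : ℤ) T) :
    ∀ᵐ ω ∂P, lagVector d Y (u + 1) ω
      = push (lagVector d Y u ω) (m (lagVector d Y u ω) + v u ω) := by
  filter_upwards [h.recursion u hu] with ω hω
  rw [← hω]
  ext i
  simp only [lagVector, push]
  split_ifs with hi
  · rw [show u + 1 - 1 - ((i : ℕ) : ℤ) = u by omega]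
  · rw [show u + 1 - 1 - ((i : ℕ) : ℤ) = u - 1 - ((i - 1 : ℕ) : ℤ) by omega]

/-- The path of the process over `[s, u]`, extended by zero. -/
def recordedPath {Ω : Type*} (Y : ℤ → Ω → ℝ) (s u : ℤ) (ω : Ω) : ℤ → ℝ :=
  fun r => if r ∈ Set.Icc s u then Y r ω else 0

omit mΩ in
lemma measurable_recordedPath (Y : ℤ → Ω → ℝ) (s u : ℤ) :
    Measurable[sigmaField Y s u] (recordedPath Y s u) := by
  refine @measurable_pi_lambda _ _ _ (_) _ _ fun r => ?_
  unfold recordedPath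
  split_ifs with hr
  · exact measurable_sigmaField hr
  · exact @measurable_const _ _ _ (_) _

omit mΩ in
lemma sigmaField_le_comap_recordedPath (Y : ℤ → Ω → ℝ) (s u : ℤ) :
    sigmaField Y s u ≤ MeasurableSpace.comap (recordedPath Y s u) inferInstance := by
  refine iSup₂_le fun r hr => ?_
  rintro _ ⟨A, hA, rfl⟩
  refine ⟨(fun w => w r) ⁻¹' A, measurable_pi_apply _ hA, ?_⟩
  ext ω
  simp [recordedPath, hr.1, hr.2]

lemma IsNonlinearAR.recordedPath_succ (h : IsNonlinearAR P d T ν m Y v) {s u : ℤ}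
    (hu : u ∈ Set.Icc (1 : ℤ) T) (hs : s ≤ u) :
    ∀ᵐ ω ∂P, recordedPath Y s u ω
      = Function.update (recordedPath Y s (u - 1) ω) u (m (lagVector d Y u ω) + v u ω) := by
  filter_upwards [h.recursion u hu] with ω hω
  rw [← hω]
  ext r
  by_cases hr : r = u
  · subst hr
    simp [recordedPath, hs]
  · rw [Function.update_of_ne hr]
    simp only [recordedPath, Set.mem_Icc]
    congr 1
    refine propext ⟨fun h => ⟨h.1, by omega⟩, fun h => ⟨h.1, by omega⟩⟩

/-- This is the Markov property in integrated form: the innovation at time `u` is independent of the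
state before it and of `A`. -/
lemma IsNonlinearAR.setIntegral_step [IsProbabilityMeasure P] (h : IsNonlinearAR P d T ν m Y v)
    (hm : Measurable m) {u : ℤ} (hu : u ∈ Set.Icc (1 : ℤ) T) {A : Set Ω}
    (hA : MeasurableSet[sigmaField Y (1 - d) (u - 1)] A) {g : (Fin d → ℝ) → ℝ}
    (hg : UnitMeasurable g) :
    ∫ ω in A, g (lagVector d Y (u + 1) ω) ∂P
      = ∫ ω in A, kernelOp (pushKernel m (gaussianReal 0 1)) g (lagVector d Y u ω) ∂P := by
  have hZ : Measurable[sigmaField Y (1 - d) (u - 1)] (lagVector d Y u) := by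
    simpa using measurable_lagVector (d := d) (Y := Y) (u := u - 1) (by have := hu.1; omega)
  have e := setIntegral_eq_setIntegral_of_indep (h.sigmaField_le (by have := hu.2; omega)) hZ
    (h.measurable_v u hu) (h.indep_past hm hu) hA
    (F := fun p => g (push p.1 (m p.1 + p.2))) (hg.1.comp (measurable_push_add hm))
    fun p => hg.2 _
  simp only [h.law_v u hu] at e
  simp only [kernelOp_pushKernel hm _ hg.1]
  rw [← e]
  refine integral_congr_ae (ae_restrict_of_ae ?_)
  filter_upwards [h.lagVector_succ hu] with ω hω
  rw [hω]

lemma IsNonlinearAR.setIntegral_iterate [IsProbabilityMeasure P]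
    (h : IsNonlinearAR P d T ν m Y v) (hm : Measurable m) {k : ℤ} (hk : 0 ≤ k) {A : Set Ω}
    (hA : MeasurableSet[sigmaField Y (1 - d) k] A) (n : ℕ) (hn : k + n ≤ T)
    {g : (Fin d → ℝ) → ℝ} (hg : UnitMeasurable g) :
    ∫ ω in A, g (lagVector d Y (k + n + 1) ω) ∂P
      = ∫ ω in A, (kernelOp (pushKernel m (gaussianReal 0 1)))^[n] g
          (lagVector d Y (k + 1) ω) ∂P := by
  have := isMarkovKernel_pushKernel (μ := gaussianReal 0 1) hm
  induction n generalizing g with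
  | zero => simp
  | succ n ih =>
    have e := h.setIntegral_step hm (u := k + (n + 1 : ℕ)) ⟨by omega, hn⟩ (A := A)
      (sigmaField_mono le_rfl (by omega) A hA) hg
    rw [e, Function.iterate_succ_apply, ← ih (by omega) hg.kernelOp]
    simp [add_assoc]

/-- The conditional mean of a bounded function of the path after time `s - 1`, given the past,
is a function of the state at time `s - 1`. -/
lemma IsNonlinearAR.exists_setIntegral_eq [IsProbabilityMeasure P]
    (h : IsNonlinearAR P d T ν m Y v) (hm : Measurable m) {s : ℤ} (hs : 1 ≤ s) (n : ℕ)
    (hn : s - 1 + n ≤ T) {f : (Fin d → ℝ) × (ℤ → ℝ) → ℝ} (hf : UnitMeasurable f) :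
    ∃ g : (Fin d → ℝ) → ℝ, UnitMeasurable g ∧
      ∀ A, MeasurableSet[sigmaField Y (1 - d) (s - 1)] A →
        ∫ ω in A, f (lagVector d Y (s + n) ω, recordedPath Y s (s - 1 + n) ω) ∂P
          = ∫ ω in A, g (lagVector d Y s ω) ∂P := by
  induction n generalizing f with
  | zero =>
    refine ⟨fun x => f (x, 0), ⟨hf.1.comp measurable_prodMk_right, fun x => hf.2 _⟩,
      fun A _ => ?_⟩
    have : ∀ ω, recordedPath Y s (s - 1) ω = 0 := fun ω => by
      ext r
      simp only [recordedPath, Set.mem_Icc]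
      rw [if_neg (by omega)]
      rfl
    simp only [this, Nat.cast_zero, add_zero]
  | succ n ih =>
    have hu : s + n ∈ Set.Icc (1 : ℤ) T := ⟨by omega, by push_cast at hn; omega⟩
    have hF : Measurable fun p : ((Fin d → ℝ) × (ℤ → ℝ)) × ℝ =>
        f (push p.1.1 (m p.1.1 + p.2), Function.update p.1.2 (s + n) (m p.1.1 + p.2)) := by
      have hmp : Measurable fun p : ((Fin d → ℝ) × (ℤ → ℝ)) × ℝ => m p.1.1 + p.2 :=
        (hm.comp (measurable_fst.comp measurable_fst)).add measurable_snd
      refine hf.1.comp ((measurable_push.comp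
        ((measurable_fst.comp measurable_fst).prodMk hmp)).prodMk ?_)
      refine measurable_pi_lambda _ fun r => ?_
      by_cases hr : r = s + n
      · subst hr
        simpa using hmp
      · simp only [Function.update_of_ne hr]
        fun_prop
    -- Integrating out the last innovation leaves a bounded function of the state and of a path one
    -- step shorter; keeping the state as a separate argument of `f` is what closes the induction.
    obtain ⟨g, hg, hgA⟩ := ih (by omega) (f := fun p => ∫ z,
      f (push p.1 (m p.1 + z), Function.update p.2 (s + n) (m p.1 + z)) ∂gaussianReal 0 1)
      ⟨hF.stronglyMeasurable.integral_prod_right'.measurable,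
        fun p => abs_integral_le_one fun z => hf.2 _⟩
    refine ⟨g, hg, fun A hA => ?_⟩
    rw [← hgA A hA]
    have hZ : Measurable[sigmaField Y (1 - d) (s + n - 1)]
        fun ω => (lagVector d Y (s + n) ω, recordedPath Y s (s - 1 + n) ω) := by
      refine @Measurable.prodMk _ _ _ _ _ (_) _ _ ?_ ?_
      · simpa using measurable_lagVector (d := d) (Y := Y) (u := s + n - 1) (by omega)
      · exact (measurable_recordedPath Y s (s - 1 + n)).mono
          (sigmaField_mono (by omega) (by omega)) le_rfl
    have e := setIntegral_eq_setIntegral_of_indep (h.sigmaField_le (by have := hu.2; omega)) hZ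
      (h.measurable_v _ hu) (h.indep_past hm hu)
      (sigmaField_mono le_rfl (by omega) A hA) hF fun p => hf.2 _
    simp only [h.law_v _ hu] at e
    rw [← e]
    refine integral_congr_ae (ae_restrict_of_ae ?_)
    filter_upwards [h.lagVector_succ hu, h.recordedPath_succ hu (s := s) (by omega)] with ω h1 h2
    have e1 : s + ((n + 1 : ℕ) : ℤ) = s + n + 1 := by push_cast; ring
    have e2 : s - 1 + ((n + 1 : ℕ) : ℤ) = s + n := by push_cast; ring
    have e3 : s + n - 1 = s - 1 + n := by ring
    rw [e1, e2, h1, h2, e3]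

/-- `K / (1 - γ)` is the fixed point of `r ↦ γ r + K`, and the initial moment does not grow because
`γ ≤ 1`. -/
lemma IsNonlinearAR.lintegral_lagVector_le [IsProbabilityMeasure P]
    (h : IsNonlinearAR P d T ν m Y v) (hm : Measurable m) {V : (Fin d → ℝ) → ℝ≥0}
    (hV : Measurable V) {γ K : ℝ≥0} (hγ : γ < 1)
    (hd : ∀ x, ∫⁻ z, (V (push x (m x + z)) : ℝ≥0∞) ∂gaussianReal 0 1 ≤ (γ * V x + K : ℝ≥0))
    (n : ℕ) (hn : n ≤ T) :
    ∫⁻ ω, (V (lagVector d Y (n + 1) ω) : ℝ≥0∞) ∂P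
      ≤ ∫⁻ x, (V x : ℝ≥0∞) ∂ν + (K / (1 - γ) : ℝ≥0) := by
  have hVe : Measurable fun x => (V x : ℝ≥0∞) := hV.coe_nnreal_ennreal
  induction n with
  | zero =>
    rw [← h.law_init, lintegral_map hVe h.measurable_lagVector_one]
    simp
  | succ n ih =>
    have hu : (n + 1 : ℤ) ∈ Set.Icc (1 : ℤ) T := ⟨by omega, by exact_mod_cast hn⟩
    have hZ : Measurable[sigmaField Y (1 - d) ((n : ℤ) + 1 - 1)] (lagVector d Y (n + 1)) := by
      rw [add_sub_cancel_right]
      exact measurable_lagVector (by omega)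
    have e := lintegral_eq_lintegral_of_indep (h.sigmaField_le (by omega)) hZ
      (h.measurable_v _ hu) (h.indep_past hm hu)
      (F := fun p => (V (push p.1 (m p.1 + p.2)) : ℝ≥0∞)) (hVe.comp (measurable_push_add hm))
    simp only [h.law_v _ hu] at e
    have hZm : Measurable (lagVector d Y (n + 1)) := hZ.mono (h.sigmaField_le (by omega)) le_rfl
    have hK : γ * (K / (1 - γ)) + K = K / (1 - γ) := by
      have : 1 - γ ≠ 0 := (tsub_pos_of_lt hγ).ne'
      calc γ * (K / (1 - γ)) + K = γ * (K / (1 - γ)) + (1 - γ) * (K / (1 - γ)) := by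
            rw [mul_div_cancel₀ _ this]
        _ = _ := by rw [← add_mul, add_tsub_cancel_of_le hγ.le, one_mul]
    calc ∫⁻ ω, (V (lagVector d Y ((n + 1 : ℕ) + 1) ω) : ℝ≥0∞) ∂P
        = ∫⁻ ω, (V (push (lagVector d Y (n + 1) ω)
            (m (lagVector d Y (n + 1) ω) + v (n + 1) ω)) : ℝ≥0∞) ∂P := by
          refine lintegral_congr_ae ?_
          filter_upwards [h.lagVector_succ hu] with ω hω
          rw [← hω]
          norm_cast
      _ ≤ ∫⁻ ω, (γ * (V (lagVector d Y (n + 1) ω) : ℝ≥0∞) + K) ∂P := by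
          rw [e]
          refine lintegral_mono fun ω => (hd _).trans_eq ?_
          push_cast
          rfl
      _ ≤ γ * (∫⁻ x, (V x : ℝ≥0∞) ∂ν + (K / (1 - γ) : ℝ≥0)) + K := by
          rw [lintegral_add_right _ measurable_const, lintegral_const_mul _ (by fun_prop)]
          simp only [lintegral_const, measure_univ, mul_one]
          gcongr
          exact ih (by omega)
      _ = γ * ∫⁻ x, (V x : ℝ≥0∞) ∂ν + (γ * (K / (1 - γ)) + K : ℝ≥0) := by
          rw [ENNReal.coe_add, ENNReal.coe_mul]
          ring
      _ ≤ 1 * ∫⁻ x, (V x : ℝ≥0∞) ∂ν + (K / (1 - γ) : ℝ≥0) := by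
          rw [hK]
          gcongr
          exact_mod_cast hγ.le
      _ = _ := by rw [one_mul]

end Autoregression

/-! ### Bounding the β-coefficient by duality. -/

section BetaCoefficient

variable {Ω : Type*} {𝒜 ℬ : MeasurableSpace Ω} [mΩ : MeasurableSpace Ω] {P : Measure Ω}

/-- Attaching to each cell `B j` the sign of its covariance with `A` turns the sum of absolute
values into the covariance of `A` with one bounded function. -/
lemma IsFinitePartition.exists_signs [IsProbabilityMeasure P] (hℬ : ℬ ≤ mΩ) {n : ℕ}
    {B : Fin n → Set Ω} (hB : IsFinitePartition ℬ B) (A : Set Ω) :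
    ∃ h : Ω → ℝ, Measurable[ℬ] h ∧ (∀ ω, |h ω| ≤ 1) ∧
      ∑ j, |P.real (A ∩ B j) - P.real A * P.real (B j)|
        = ∫ ω in A, h ω ∂P - P.real A * ∫ ω, h ω ∂P := by
  classical
  let σ : Fin n → ℝ := fun j => if 0 ≤ P.real (A ∩ B j) - P.real A * P.real (B j) then 1 else -1
  have hσ : ∀ j, |σ j| ≤ 1 := fun j => by
    simp only [σ]
    split_ifs <;> simp
  have hBm : ∀ j, MeasurableSet (B j) := fun j => hℬ _ (hB.measurableSet j)
  have hint : ∀ D, ∫ ω in D, ∑ j, σ j * (B j).indicator 1 ω ∂P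
      = ∑ j, σ j * P.real (D ∩ B j) := fun D => by
    have hi : ∀ j ∈ Finset.univ, Integrable (fun ω => σ j * (B j).indicator (1 : Ω → ℝ) ω)
        (P.restrict D) := fun j _ =>
      (((integrable_const (1 : ℝ)).indicator (hBm j)).const_mul _)
    rw [integral_finsetSum _ hi]
    refine Finset.sum_congr rfl fun j _ => ?_
    rw [integral_const_mul, integral_indicator_one (hBm j),
      measureReal_restrict_apply (hBm j), Set.inter_comm]
  refine ⟨fun ω => ∑ j, σ j * (B j).indicator 1 ω, ?_, fun ω => ?_, ?_⟩
  · refine @Finset.measurable_fun_sum _ _ _ _ _ _ _ (_) _ fun j _ => ?_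
    exact @Measurable.const_mul _ _ _ _ _ (_) _
      (@Measurable.indicator _ _ (_) _ _ _ _ (@measurable_const _ _ _ (_) 1)
        (hB.measurableSet j)) _
  · obtain ⟨j, hj⟩ := Set.mem_iUnion.1 (hB.iUnion_eq.symm ▸ Set.mem_univ ω : ω ∈ ⋃ i, B i)
    dsimp only
    rw [Finset.sum_eq_single j]
    · simpa [hj] using hσ j
    · intro i _ hi
      rw [Set.indicator_of_notMem fun h => Set.disjoint_left.1 (hB.disjoint i j hi) h hj, mul_zero]
    · simp
  · rw [hint, ← setIntegral_univ, hint, Finset.mul_sum, ← Finset.sum_sub_distrib]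
    refine Finset.sum_congr rfl fun j _ => ?_
    rw [Set.univ_inter]
    simp only [σ]
    split_ifs with h
    · rw [abs_of_nonneg h]; ring
    · rw [abs_of_neg (not_le.1 h)]; ring

/-- The β-mixing coefficient is controlled by the weighted oscillation of conditional means. -/
lemma betaCoeff_le_of_oscLE [IsProbabilityMeasure P] {E : Type*} [MeasurableSpace E]
    (h𝒜 : 𝒜 ≤ mΩ) (hℬ : ℬ ≤ mΩ) {Z : Ω → E} (hZ : Measurable Z) {V : E → ℝ≥0} (hV : Measurable V)
    {M : ℝ≥0} (hM : ∫⁻ ω, (V (Z ω) : ℝ≥0∞) ∂P ≤ M) {ε β : ℝ} (hε : 0 ≤ ε) (hβ : 0 ≤ β)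
    (H : ∀ h : Ω → ℝ, Measurable[ℬ] h → (∀ ω, |h ω| ≤ 1) → ∃ g : E → ℝ, UnitMeasurable g ∧
      OscLE V β ε g ∧ ∀ A, MeasurableSet[𝒜] A → ∫ ω in A, h ω ∂P = ∫ ω in A, g (Z ω) ∂P) :
    betaCoeff P 𝒜 ℬ ≤ ENNReal.ofReal (ε * (1 + β * M)) := by
  obtain ⟨hVi, hVM⟩ := integrable_of_drift (V := fun ω => V (Z ω)) (hV.comp hZ) hM
  -- `F` dominates `g (Z ω)` minus its mean for every admissible `g`. Although `g` changes with the
  -- cell `A i`, `F` does not, so the cell bounds add up to `∫ F`.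
  set F : Ω → ℝ := fun ω => ε * (2 + β * V (Z ω) + β * M) with hF
  have hFi : Integrable F P :=
    (((integrable_const _).add (hVi.const_mul _)).add (integrable_const _)).const_mul _
  have hcell : ∀ (A : Set Ω), MeasurableSet[𝒜] A → ∀ (k : ℕ) (B : Fin k → Set Ω),
      IsFinitePartition ℬ B →
      ∑ j, |P.real (A ∩ B j) - P.real A * P.real (B j)| ≤ ∫ ω in A, F ω ∂P := by
    intro A hA k B hB
    obtain ⟨h, hm, hb, he⟩ := hB.exists_signs (P := P) hℬ A
    obtain ⟨g, hg, ho, hgA⟩ := H h hm hb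
    have hgi : Integrable (fun ω => g (Z ω)) P :=
      integrable_of_bounded (hg.1.comp hZ) fun ω => hg.2 _
    have huniv := hgA Set.univ MeasurableSet.univ
    rw [setIntegral_univ, setIntegral_univ] at huniv
    rw [he, hgA A hA, huniv]
    have e : ∫ ω in A, g (Z ω) ∂P - P.real A * ∫ ω, g (Z ω) ∂P
        = ∫ ω in A, (g (Z ω) - ∫ ω', g (Z ω') ∂P) ∂P := by
      rw [integral_sub hgi.integrableOn (integrable_const _), setIntegral_const, smul_eq_mul]
    rw [e]
    refine setIntegral_mono ((hgi.sub (integrable_const _)).integrableOn) hFi.integrableOn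
      fun ω => ?_
    have e2 : g (Z ω) - ∫ ω', g (Z ω') ∂P = ∫ ω', (g (Z ω) - g (Z ω')) ∂P := by
      rw [integral_sub (integrable_const _) hgi]
      simp
    have hi2 : Integrable (fun ω' => ε * (2 + β * V (Z ω) + β * V (Z ω'))) P :=
      ((integrable_const _).add (hVi.const_mul _)).const_mul _
    calc g (Z ω) - ∫ ω', g (Z ω') ∂P
        ≤ ∫ ω', ε * (2 + β * V (Z ω) + β * V (Z ω')) ∂P := by
          rw [e2]
          exact integral_mono ((integrable_const _).sub hgi) hi2
            fun ω' => (le_abs_self _).trans (ho _ _)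
      _ = ε * (2 + β * V (Z ω) + β * ∫ ω', (V (Z ω') : ℝ) ∂P) := by
          rw [integral_const_mul, integral_add (integrable_const _) (hVi.const_mul _),
            integral_const_mul]
          simp
      _ ≤ F ω := by
          simp only [hF]
          gcongr
  have htot : ∫ ω, F ω ∂P ≤ 2 * (ε * (1 + β * M)) := by
    have hi : Integrable (fun ω => 2 + β * (V (Z ω) : ℝ)) P :=
      (integrable_const _).add (hVi.const_mul _)
    have : ∫ ω, F ω ∂P = ε * (2 + β * ∫ ω, (V (Z ω) : ℝ) ∂P + β * M) := by
      simp only [hF]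
      rw [integral_const_mul, integral_add hi (integrable_const _),
        integral_add (integrable_const _) (hVi.const_mul _), integral_const_mul]
      simp
    rw [this]
    calc ε * (2 + β * ∫ ω, (V (Z ω) : ℝ) ∂P + β * M) ≤ ε * (2 + β * M + β * M) := by gcongr
      _ = _ := by ring
  have hsup : (⨆ (n : ℕ) (k : ℕ) (A : Fin n → Set Ω) (B : Fin k → Set Ω)
      (_ : IsFinitePartition 𝒜 A) (_ : IsFinitePartition ℬ B),
      ENNReal.ofReal (∑ i, ∑ j, |P.real (A i ∩ B j) - P.real (A i) * P.real (B j)|))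
      ≤ ENNReal.ofReal (2 * (ε * (1 + β * M))) := by
    refine iSup_le fun n => iSup_le fun k => iSup_le fun A => iSup_le fun B => iSup_le fun hA =>
      iSup_le fun hB => ENNReal.ofReal_le_ofReal ?_
    calc ∑ i, ∑ j, |P.real (A i ∩ B j) - P.real (A i) * P.real (B j)|
        ≤ ∑ i, ∫ ω in A i, F ω ∂P :=
          Finset.sum_le_sum fun i _ => hcell _ (hA.measurableSet i) k B hB
      _ = ∫ ω in ⋃ i, A i, F ω ∂P :=
          (integral_iUnion_fintype (fun i => h𝒜 _ (hA.measurableSet i))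
            (fun i j hij => hA.disjoint i j hij) fun i => hFi.integrableOn).symm
      _ ≤ _ := by
          rw [hA.iUnion_eq, setIntegral_univ]
          exact htot
  rw [betaCoeff]
  refine (mul_le_mul_right hsup _).trans_eq ?_
  rw [ENNReal.ofReal_mul zero_le_two, ENNReal.ofReal_ofNat, ← mul_assoc,
    ENNReal.inv_mul_cancel two_ne_zero ENNReal.ofNat_ne_top, one_mul]

end BetaCoefficient

/-! ### Assembling the rate. -/

section Mixing

variable {d : ℕ}

lemma oscLE_iterate_of_contraction {E : Type*} [MeasurableSpace E] {κ : Kernel E E}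
    [IsMarkovKernel κ] {V : E → ℝ≥0} {β ρ : ℝ} (hβ : 0 ≤ β) (hρ : 0 ≤ ρ) {d : ℕ}
    (hc : ∀ φ : E → ℝ, UnitMeasurable φ → ∀ L : ℝ, 0 ≤ L → OscLE V β L φ →
      OscLE V β (ρ * L) (kernelOp (κ ^ d) φ)) {φ : E → ℝ} (hφ : UnitMeasurable φ) (n : ℕ) :
    OscLE V β (ρ ^ (n / d)) ((kernelOp κ)^[n] φ) := by
  have hmul : ∀ (q : ℕ) (φ : E → ℝ), UnitMeasurable φ →
      OscLE V β (ρ ^ q) ((kernelOp κ)^[d * q] φ) := by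
    intro q φ hφ
    induction q with
    | zero =>
      intro x y
      have h1 := abs_le.1 (hφ.2 x)
      have h2 := abs_le.1 (hφ.2 y)
      have : 0 ≤ β * V x + β * V y := by positivity
      simp only [mul_zero, Function.iterate_zero, id_eq, pow_zero, one_mul]
      exact abs_le.2 ⟨by linarith, by linarith⟩
    | succ q ih =>
      have hq := hφ.iterate_kernelOp (κ := κ) (d * q)
      rw [mul_add, mul_one, add_comm (d * q), Function.iterate_add_apply,
        iterate_kernelOp_eq hq, pow_succ']
      exact hc _ hq _ (by positivity) ih
  -- The `n % d` leftover steps act on `φ` first and keep it bounded by one, hence of weighted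
  -- oscillation at most one.
  have := hmul (n / d) _ (hφ.iterate_kernelOp (κ := κ) (n % d))
  rwa [← Function.iterate_add_apply, Nat.div_add_mod] at this

lemma IsNonlinearAR.betaMixing_le {Ω : Type*} [mΩ : MeasurableSpace Ω] {P : Measure Ω}
    [IsProbabilityMeasure P] {T : ℕ} {ν : Measure (Fin d → ℝ)} {m : (Fin d → ℝ) → ℝ}
    {Y v : ℤ → Ω → ℝ} (h : IsNonlinearAR P d T ν m Y v) (hd : 1 ≤ d) (hm : Measurable m)
    {V : (Fin d → ℝ) → ℝ≥0} (hV : Measurable V) {M : ℝ≥0}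
    (hM : ∀ n : ℕ, n ≤ T → ∫⁻ ω, (V (lagVector d Y (n + 1) ω) : ℝ≥0∞) ∂P ≤ M)
    {t : ℕ} (ht : 1 ≤ t) {ε β : ℝ} (hε : 0 ≤ ε) (hβ : 0 ≤ β)
    (H : ∀ g : (Fin d → ℝ) → ℝ, UnitMeasurable g →
      OscLE V β ε ((kernelOp (pushKernel m (gaussianReal 0 1)))^[t - 1] g)) :
    betaMixing P Y T t ≤ ENNReal.ofReal (ε * (1 + β * M)) := by
  have := isMarkovKernel_pushKernel (μ := gaussianReal 0 1) hm
  refine iSup₂_le fun k hk => ?_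
  obtain ⟨hk1, hkT⟩ := hk
  lift k to ℕ using by omega
  have h𝒜 : sigmaField Y 1 k ≤ sigmaField Y (1 - d) k := sigmaField_mono (by omega) le_rfl
  have hℬ : sigmaField Y (k + t) T ≤ sigmaField Y (1 - d) T := sigmaField_mono (by omega) le_rfl
  refine betaCoeff_le_of_oscLE (h𝒜.trans (h.sigmaField_le (by omega)))
    (hℬ.trans (h.sigmaField_le le_rfl)) ((measurable_lagVector (by omega)).mono
    (h.sigmaField_le (by omega)) le_rfl) hV (hM k (by omega)) hε hβ fun f hf hfb => ?_
  -- Doob–Dynkin factorization through the path; `f'` need not be bounded off the range, so it is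
  -- truncated to `[-1, 1]` below.
  obtain ⟨f', hf'm, hf'⟩ := (hf.mono (sigmaField_le_comap_recordedPath Y (k + t) T)
    le_rfl).exists_eq_measurable_comp
  obtain ⟨n, hn⟩ : ∃ n : ℕ, (k + t : ℤ) - 1 + n = T := ⟨T - (k + t - 1), by omega⟩
  obtain ⟨g, hg, hgA⟩ := h.exists_setIntegral_eq hm (s := k + t) (by omega) n hn.le
    (f := fun p => max (-1) (min 1 (f' p.2)))
    ⟨measurable_const.max (measurable_const.min (hf'm.comp measurable_snd)), fun p =>
      abs_le.2 ⟨le_max_left _ _, max_le (by norm_num) (min_le_left _ _)⟩⟩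
  -- The state at time `k` is `lagVector d Y (k + 1)` and `g` is evaluated at `lagVector d Y (k +
  -- t)`: `t - 1` steps.
  refine ⟨_, hg.iterate_kernelOp (t - 1), H g hg, fun A hA => ?_⟩
  rw [← h.setIntegral_iterate hm (by omega) (h𝒜 A hA) (t - 1) (by omega) hg]
  have e : (k : ℤ) + (t - 1 : ℕ) + 1 = k + t := by omega
  rw [e, ← hgA A (sigmaField_mono le_rfl (by omega) A (h𝒜 A hA)), hn]
  refine integral_congr_ae (ae_of_all _ fun ω => ?_)
  have h1 : f' (recordedPath Y (k + t) T ω) = f ω := (congrFun hf' ω).symm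
  have h2 := abs_le.1 (hfb ω)
  simp only [h1]
  rw [min_eq_right h2.2, max_eq_right h2.1]

/-- Rounding costs one factor: `t / d ≤ ⌊(t - 1) / d⌋ + 1`, whence `ρ⁻¹`. -/
lemma pow_div_le_exp {ρ : ℝ} (hρ0 : 0 < ρ) (hρ1 : ρ < 1) (hd : 1 ≤ d) {t : ℕ} (ht : 1 ≤ t) :
    ρ ^ ((t - 1) / d) ≤ ρ⁻¹ * Real.exp (-(-Real.log ρ / d) * t) := by
  have hd0 : (0 : ℝ) < d := by exact_mod_cast hd
  have hlog : Real.log ρ < 0 := Real.log_neg hρ0 hρ1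
  have hq : (t : ℝ) / d ≤ ((t - 1) / d : ℕ) + 1 := by
    rw [div_le_iff₀ hd0]
    have h1 := Nat.div_add_mod (t - 1) d
    have h2 := Nat.mod_lt (t - 1) hd
    have h3 : t ≤ ((t - 1) / d + 1) * d := by
      rw [add_mul, one_mul, mul_comm]
      omega
    exact_mod_cast h3
  have e1 : ρ ^ ((t - 1) / d) = Real.exp (((t - 1) / d : ℕ) * Real.log ρ) := by
    rw [Real.exp_nat_mul, Real.exp_log hρ0]
  have e2 : ρ⁻¹ = Real.exp (-Real.log ρ) := by rw [Real.exp_neg, Real.exp_log hρ0]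
  rw [e1, e2, ← Real.exp_add]
  refine Real.exp_le_exp.2 ?_
  have e3 : -Real.log ρ + -(-Real.log ρ / d) * t = (t / d - 1) * Real.log ρ := by
    field_simp
    ring
  rw [e3]
  exact mul_le_mul_of_nonpos_right (by linarith) hlog.le

lemma lintegral_weightedNorm_ne_top (w : ℕ → ℝ≥0) {ν : Measure (Fin d → ℝ)}
    (hν : Integrable (fun x : Fin d → ℝ => Real.sqrt (∑ i, x i ^ 2)) ν) :
    ∫⁻ x, (weightedNorm w x : ℝ≥0∞) ∂ν ≠ ∞ := by
  have hi : Integrable (fun x : Fin d → ℝ => (weightedNorm w x : ℝ)) ν := by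
    refine (hν.const_mul (∑ i : Fin d, (w i : ℝ))).mono'
      (measurable_weightedNorm w).coe_nnreal_real.aestronglyMeasurable (ae_of_all _ fun x => ?_)
    rw [Real.norm_of_nonneg (NNReal.coe_nonneg _), weightedNorm, NNReal.coe_sum, Finset.sum_mul]
    refine Finset.sum_le_sum fun i _ => ?_
    rw [NNReal.coe_mul]
    gcongr
    exact Real.abs_le_sqrt (Finset.single_le_sum (f := fun i => x i ^ 2)
      (fun i _ => sq_nonneg _) (Finset.mem_univ i))
  refine ne_of_eq_of_ne ?_ hi.2.ne
  exact lintegral_congr fun x => by simp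

end Mixing

end

theorem mainTheorem8 (d : ℕ) (hd : 1 ≤ d) (c : Fin (d + 1) → ℝ) (hc : ∀ i, 0 < c i)
    (hc1 : ∑ i : Fin d, c i.succ < 1)
    (ν : Measure (Fin d → ℝ)) [IsProbabilityMeasure ν]
    (hν : Integrable (fun x : Fin d → ℝ => Real.sqrt (∑ i, x i ^ 2)) ν) :
    ∃ C C' : ℝ, 0 < C ∧ 0 < C' ∧
      ∀ m ∈ regressionClass c, ∀ (T : ℕ) (Ω : Type*) [MeasurableSpace Ω] (P : Measure Ω)
        [IsProbabilityMeasure P] (Y v : ℤ → Ω → ℝ), IsNonlinearAR P d T ν m Y v →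
        ∀ t : ℕ, 1 ≤ t → betaMixing P Y T t ≤ ENNReal.ofReal (C' * Real.exp (-C * t)) := by
  lift c to Fin (d + 1) → NNReal using fun i => (hc i).le
  beta_reduce at hc1
  have hs : ∑ i : Fin d, c i.succ < 1 := by exact_mod_cast hc1
  obtain ⟨w, γ, hγ, hwd, hw0, hw⟩ := exists_weights hd hs
  set V : (Fin d → ℝ) → NNReal := weightedNorm w with hVdef
  have hV : Measurable V := measurable_weightedNorm w
  set K := driftConst (w 0) (c 0) with hK
  have hγ' : 0 < 1 - (γ : ℝ) := sub_pos.2 (by exact_mod_cast hγ)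
  -- The `d`-step drift constant is `d * K`; the small set must reach beyond `2dK / (1 - γ)`. All
  -- constants are fixed before `m` and `T` appear.
  obtain ⟨R, hR⟩ : ∃ R : NNReal, 2 * ((d * K : NNReal) : ℝ) < (1 - γ) * R := by
    refine ⟨((2 * (d * K : NNReal) + 1) / (1 - γ) : ℝ).toNNReal, ?_⟩
    rw [Real.coe_toNNReal _ (by positivity), mul_div_cancel₀ _ hγ'.ne']
    linarith
  obtain ⟨r, hr, hbox⟩ := exists_box w hw0 R
  -- This `M` bounds every admissible `m` on the box of radius `r`.
  obtain ⟨μ, a, ha, hμ, hmin⟩ := exists_minorization d (M := c 0 + ∑ i : Fin d, c i.succ * r) hr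
  obtain ⟨β, ρ, hβ, hρ0, hρ1, hcontr⟩ :=
    exists_oscLE_contraction (E := Fin d → ℝ) hγ hR ha
  set M := (∫⁻ x, (V x : ℝ≥0∞) ∂ν).toNNReal + K / (1 - γ) with hM
  have hd0 : (0 : ℝ) < d := by exact_mod_cast hd
  refine ⟨-Real.log ρ / d, ρ⁻¹ * (1 + β * M),
    div_pos (neg_pos.2 (Real.log_neg hρ0 hρ1)) hd0, by positivity, ?_⟩
  intro m hmc T Ω _ P _ Y v h t ht
  obtain ⟨hm, hmb⟩ := hmc
  have := isMarkovKernel_pushKernel (μ := gaussianReal 0 1) hm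
  have hmn : ∀ x, ‖m x‖₊ ≤ c 0 + ∑ i : Fin d, c i.succ * ‖x i‖₊ := fun x => by
    have := hmb x
    rw [← NNReal.coe_le_coe]
    push_cast
    exact this
  have hdrift := lintegral_weightedNorm_push_le hd hwd hw hmn
  have hkdrift : ∀ x, ∫⁻ y, (V y : ℝ≥0∞) ∂pushKernel m (gaussianReal 0 1) x
      ≤ (γ * V x + K : NNReal) := fun x => by
    rw [lintegral_pushKernel hm x hV.coe_nnreal_ennreal]
    exact hdrift x
  have hpow : ∀ x, ∫⁻ y, (V y : ℝ≥0∞) ∂(pushKernel m (gaussianReal 0 1) ^ d) x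
      ≤ (γ * V x + d * K : NNReal) := fun x => by
    have := lintegral_pow_succ_le_of_drift hV hγ.le hkdrift (d - 1) x
    rw [Nat.sub_add_cancel hd] at this
    convert this using 4
    exact_mod_cast (Nat.sub_add_cancel hd).symm
  have hminor : ∀ x, V x ≤ R → μ ≤ (pushKernel m (gaussianReal 0 1) ^ d) x := fun x hx =>
    hmin m hm (fun y hy => (hmb y).trans (by gcongr with i; exact hy i)) x (hbox x hx)
  have hbeta := h.betaMixing_le hd hm hV (M := M) (fun n hn => by
      refine (h.lintegral_lagVector_le hm hV hγ hdrift n hn).trans_eq ?_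
      rw [hM, ENNReal.coe_add, ENNReal.coe_toNNReal (lintegral_weightedNorm_ne_top w hν)])
    ht (pow_nonneg hρ0.le ((t - 1) / d)) hβ.le fun g hg =>
      oscLE_iterate_of_contraction hβ.le hρ0.le
        (hcontr V _ μ hV hpow hminor hμ.ge) hg (t - 1)
  refine hbeta.trans (ENNReal.ofReal_le_ofReal ?_)
  calc ρ ^ ((t - 1) / d) * (1 + β * M)
      ≤ ρ⁻¹ * Real.exp (-(-Real.log ρ / d) * t) * (1 + β * M) := by
        gcongr
        exact pow_div_le_exp hρ0 hρ1 hd ht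
    _ = _ := by ring
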